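/- A $\mathbb{Z}_4$-code of length $n$ is a $\mathbb{Z}_4$-submodule $C$ of $\mathbb{Z}_4^n$; its residue code is the binary linear code $C^{(1)}=\{c \bmod 2 \mid c\in C\}$. Two $\mathbb{Z}_4$-codes are equivalent if one is obtained from the other by permuting the coordinates and changing the signs of certain coordinates; two binary codes are equivalent if one is obtained from the other by permuting the coordinates. The Euclidean weight of $x\in\mathbb{Z}_4^n$ is $n_1(x)+4n_2(x)+n_3(x)$, where $n_\alpha(x)$ is the number of coordinates of $x$ equal to $\alpha$. The code $C$ is Type II if it is self-dual for the inner product $\sum_i x_iy_i$ and the Euclidean weights of all its codewords are divisible by $8$; a Type II code is extremal if the smallest Euclidean weight of its nonzero codewords equals $8\lfloor n/24\rfloor+8$. Let $RM(1,5)$ be the first order Reed–Muller code of length $32$, i.e. the binary code spanned by $1^{32}$, $1^{16}0^{16}$, $(1^80^8)^2$, $(1^40^4)^4$, $(1100)^8$ and $(10)^{16}$, where exponents denote repetition. Proposition 3. Up to equivalence, there is exactly one extremal Type II $\mathbb{Z}_4$-code of length $32$ whose residue code has dimension $6$. It has a representative whose residue code is equal to $RM(1,5)$, and the residue code of every such code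 is equivalent to $RM(1,5)$. -/

import Mathlib

/-- A `ℤ₄`-code of length `n`: a `ℤ₄`-submodule of `ℤ₄ⁿ`. -/
abbrev Z4Code (n : ℕ) : Type := Submodule (ZMod 4) (Fin n → ZMod 4)

/-- A binary linear code of length `n`. -/
abbrev BinaryCode (n : ℕ) : Type := Submodule (ZMod 2) (Fin n → ZMod 2)

namespace Z4Code

variable {n : ℕ}

/-- The dual code with respect to the standard inner product `x₁y₁ + ⋯ + xₙyₙ`. -/
def dual (C : Z4Code n) : Z4Code n where
  carrier := {x | ∀ y ∈ C, ∑ i, x i * y i = 0}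
  zero_mem' := by
    intro y _
    simp
  add_mem' := by
    intro a b ha hb y hy
    simp [add_mul, Finset.sum_add_distrib, ha y hy, hb y hy]
  smul_mem' := by
    intro r a ha y hy
    simp [mul_assoc, ← Finset.mul_sum, ha y hy]

/-- `C` is self-dual if it equals its dual. -/
def IsSelfDual (C : Z4Code n) : Prop := C = C.dual

/-- The number of coordinates of `x` that are equal to `a`. -/
def countOf (a : ZMod 4) (x : Fin n → ZMod 4) : ℕ :=
  (Finset.univ.filter fun i => x i = a).card

/-- The Euclidean weight `n₁(x) + 4 n₂(x) + n₃(x)`. -/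
def euclideanWeight (x : Fin n → ZMod 4) : ℕ :=
  countOf 1 x + 4 * countOf 2 x + countOf 3 x

/-- The minimum Euclidean weight: the smallest Euclidean weight among the nonzero codewords
(with value `0` for the zero code, which has none). -/
noncomputable def minEuclideanWeight (C : Z4Code n) : ℕ :=
  sInf {w | ∃ x ∈ C, x ≠ 0 ∧ euclideanWeight x = w}

/-- Type II: self-dual, with all Euclidean weights divisible by `8`. -/
def IsTypeII (C : Z4Code n) : Prop :=
  C.IsSelfDual ∧ ∀ x ∈ C, 8 ∣ euclideanWeight x

/-- Extremal Type II: the minimum Euclidean weight is `8 ⌊n/24⌋ + 8`. -/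
def IsExtremalTypeII (C : Z4Code n) : Prop :=
  C.IsTypeII ∧ C.minEuclideanWeight = 8 * (n / 24) + 8

/-- Equivalence: `D` is obtained from `C` by permuting the coordinates and changing the signs
of certain coordinates. -/
def Equivalent (C D : Z4Code n) : Prop :=
  ∃ (σ : Equiv.Perm (Fin n)) (ε : Fin n → ℤˣ),
    (D : Set (Fin n → ZMod 4)) =
      (fun (x : Fin n → ZMod 4) (i : Fin n) => (((ε i : ℤˣ) : ℤ) : ZMod 4) * x (σ i)) ''
        (C : Set (Fin n → ZMod 4))

/-- Coordinatewise reduction modulo `2`. -/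
def reduceModTwo (x : Fin n → ZMod 4) : Fin n → ZMod 2 :=
  fun i => ZMod.castHom (show 2 ∣ 4 by norm_num) (ZMod 2) (x i)

/-- The residue code `{c mod 2 | c ∈ C}`. -/
def residue (C : Z4Code n) : BinaryCode n where
  carrier := {b | ∃ c ∈ C, reduceModTwo c = b}
  zero_mem' := ⟨0, C.zero_mem, by
    funext i
    simp only [reduceModTwo, Pi.zero_apply, map_zero]⟩
  add_mem' := by
    rintro _ _ ⟨c, hc, rfl⟩ ⟨d, hd, rfl⟩
    refine ⟨c + d, C.add_mem hc hd, ?_⟩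
    funext i
    simp only [reduceModTwo, Pi.add_apply, map_add]
  smul_mem' := by
    rintro r _ ⟨c, hc, rfl⟩
    refine ⟨(r.val : ZMod 4) • c, C.smul_mem _ hc, ?_⟩
    funext i
    simp only [reduceModTwo, Pi.smul_apply, smul_eq_mul, map_mul, map_natCast,
      ZMod.natCast_zmod_val]

end Z4Code

namespace BinaryCode

/-- Equivalence of binary codes: `B'` is obtained from `B` by permuting the coordinates. -/
def Equivalent {n : ℕ} (B B' : BinaryCode n) : Prop :=
  ∃ σ : Equiv.Perm (Fin n),
    (B' : Set (Fin n → ZMod 2)) =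
      (fun (x : Fin n → ZMod 2) (i : Fin n) => x (σ i)) '' (B : Set (Fin n → ZMod 2))

/-- The generator matrix of `RM(1,5)` with first row all ones; for `j = 1, …, 5` row `j` has a
`1` in coordinate `i ∈ {0, …, 31}` exactly when the binary digit of `i` of weight `2 ^ (5 - j)`
is `0`, so the rows are `1³²`, `1¹⁶0¹⁶`, `(1⁸0⁸)²`, `(1⁴0⁴)⁴`, `(1100)⁸`, `(10)¹⁶`. -/
def rmGenerator : Fin 6 → Fin 32 → ZMod 2 :=
  ![fun _ => 1,
    fun i => if i.val.testBit 4 then 0 else 1,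
    fun i => if i.val.testBit 3 then 0 else 1,
    fun i => if i.val.testBit 2 then 0 else 1,
    fun i => if i.val.testBit 1 then 0 else 1,
    fun i => if i.val.testBit 0 then 0 else 1]

/-- The first order Reed–Muller code `RM(1,5)` of length `32`. -/
def rmOneFive : BinaryCode 32 := Submodule.span (ZMod 2) (Set.range rmGenerator)

end BinaryCode

/-!
In a self-dual code `C` the words that reduce to zero are the `2t` with `t` orthogonal to the
residue code, so `C` is determined by its residue code and by lifts of generators of it.

Existence: when all weights of the residue code are divisible by `8`, the lifts of its words with
entries `0` and `1` are orthogonal to each other, and adjoining the words `2t` gives a Type II code.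

Uniqueness: a Euclidean weight above `8` rules out the words `2(eᵢ + eⱼ)`, so the residue code
separates the `2 ^ m` coordinates. It contains `1` and has dimension `m + 1`, hence the values of
`m` further generators label the coordinates by all points of `𝔽₂ᵐ`: it is `RM(1, m)`. If lifts of
the generators `gₖ` to two such codes differ by `2uₖ`, then the matrix `uₖ · gₗ` is symmetric with
diagonal equal to its first row. Changing signs on the support of `S` adds `2 S gₖ` to the lifts,
with matrix `S · (gₖ gₗ)`. As the products `gₖ gₗ` are the monomials of degree at most two, which
are linearly independent, every admissible matrix arises from some `S`.
-/

section LinearAlgebra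

theorem exists_eq_span_range_cons {m : ℕ} {K V : Type*} [Field K] [AddCommGroup V] [Module K V]
    {B : Submodule K V} {v : V} (hv : v ∈ B) (hv0 : v ≠ 0)
    (hrank : Module.finrank K B = m + 1) :
    ∃ f : Fin m → V, B = Submodule.span K (Set.range (Fin.cons v f : Fin (m + 1) → V)) := by
  have : FiniteDimensional K B := Module.finite_of_finrank_eq_succ hrank
  obtain ⟨W, hW⟩ := Submodule.exists_isCompl (Submodule.span K {v})
  have hvB : Submodule.span K {v} ≤ B := (Submodule.span_singleton_le_iff_mem v B).2 hv
  have hsup : Submodule.span K {v} ⊔ W ⊓ B = B := by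
    rw [← sup_inf_assoc_of_le W hvB, hW.sup_eq_top, top_inf_eq]
  have hinf : Submodule.span K {v} ⊓ (W ⊓ B) = ⊥ := by
    rw [← inf_assoc, hW.inf_eq_bot, bot_inf_eq]
  have : FiniteDimensional K ↑(W ⊓ B) := Submodule.finiteDimensional_inf_right W B
  have hrankW : Module.finrank K ↑(W ⊓ B) = m := by
    have := Submodule.finrank_sup_add_finrank_inf_eq (Submodule.span K {v}) (W ⊓ B)
    rw [hsup, hinf, finrank_bot, finrank_span_singleton hv0, hrank] at this
    lia
  let b := Module.finBasisOfFinrankEq K ↑(W ⊓ B) hrankW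
  have hb : Submodule.span K (Set.range fun i => (b i : V)) = W ⊓ B := by
    rw [← Function.comp_def, Set.range_comp, ← Submodule.coe_subtype, ← Submodule.map_span,
      b.span_eq, Submodule.map_subtype_top]
  refine ⟨fun i => b i, ?_⟩
  rw [Fin.range_cons, Submodule.span_insert, hb, hsup]

theorem eq_of_separatesPoints_span {R ι κ : Type*} [Semiring R] {g : κ → ι → R}
    (hsep : (Submodule.span R (Set.range g) : Set (ι → R)).SeparatesPoints) {p q : ι}
    (h : ∀ k, g k p = g k q) : p = q := by
  by_contra hpq
  obtain ⟨r, hr, hne⟩ := hsep hpq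
  have heq : Set.EqOn (LinearMap.proj (R := R) (φ := fun _ : ι => R) p)
      (LinearMap.proj (R := R) (φ := fun _ : ι => R) q) (Set.range g) :=
    Set.forall_mem_range.2 h
  exact hne (LinearMap.eqOn_span heq hr)

end LinearAlgebra

namespace BinaryCode

section Weight

variable {ι : Type*} [Fintype ι]

theorem hammingNorm_eq_sum_val (r : ι → ZMod 2) : hammingNorm r = ∑ i, (r i).val := by
  have val_eq : ∀ a : ZMod 2, (if a ≠ 0 then 1 else 0) = a.val := by decide
  rw [hammingNorm, Finset.card_filter]
  exact Finset.sum_congr rfl fun i _ => val_eq (r i)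

theorem hammingNorm_add_add_two_mul_hammingNorm_mul (r s : ι → ZMod 2) :
    hammingNorm (r + s) + 2 * hammingNorm (r * s) = hammingNorm r + hammingNorm s := by
  have val_add : ∀ a b : ZMod 2, (a + b).val + 2 * (a * b).val = a.val + b.val := by decide
  simp only [hammingNorm_eq_sum_val, Finset.mul_sum, ← Finset.sum_add_distrib]
  exact Finset.sum_congr rfl fun i _ => val_add (r i) (s i)

theorem hammingNorm_add_le (r s : ι → ZMod 2) :
    hammingNorm (r + s) ≤ hammingNorm r + hammingNorm s := by
  have := hammingNorm_add_add_two_mul_hammingNorm_mul r s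
  lia

theorem hammingNorm_comp_perm (r : ι → ZMod 2) (σ : Equiv.Perm ι) :
    hammingNorm (r ∘ σ) = hammingNorm r := by
  simp only [hammingNorm_eq_sum_val, Function.comp_apply]
  exact Equiv.sum_comp σ fun i => (r i).val

theorem hammingNorm_one : hammingNorm (1 : ι → ZMod 2) = Fintype.card ι := by
  simp [hammingNorm]

theorem two_mul_hammingNorm_of_comp_eq_add_one {r : ι → ZMod 2} {σ : Equiv.Perm ι}
    (h : r ∘ σ = r + 1) : 2 * hammingNorm r = Fintype.card ι := by
  have := hammingNorm_add_add_two_mul_hammingNorm_mul r 1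
  rw [← h, hammingNorm_comp_perm, mul_one, hammingNorm_one] at this
  lia

theorem four_dvd_hammingNorm_mul {r s : ι → ZMod 2} (hr : 8 ∣ hammingNorm r)
    (hs : 8 ∣ hammingNorm s) (hrs : 8 ∣ hammingNorm (r + s)) : 4 ∣ hammingNorm (r * s) := by
  have := hammingNorm_add_add_two_mul_hammingNorm_mul r s
  lia

variable [DecidableEq ι]

theorem hammingNorm_single (i : ι) : hammingNorm (Pi.single i 1 : ι → ZMod 2) = 1 := by
  simp [hammingNorm_eq_sum_val, Pi.single_apply, apply_ite ZMod.val, ZMod.val_one]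

theorem exists_eq_single_add_single {t : ι → ZMod 2} (ht : hammingNorm t = 2) :
    ∃ i j, i ≠ j ∧ t = Pi.single i 1 + Pi.single j 1 := by
  obtain ⟨i, j, hij, hsupp⟩ := Finset.card_eq_two.1 ht
  refine ⟨i, j, hij, funext fun k => ?_⟩
  have hk : t k ≠ 0 ↔ k = i ∨ k = j := by simpa using Finset.ext_iff.1 hsupp k
  have eq_ite : ∀ a : ZMod 2, a = if a ≠ 0 then 1 else 0 := by decide
  rw [eq_ite (t k), Pi.add_apply, Pi.single_apply, Pi.single_apply]
  grind

end Weight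

variable {n : ℕ}

/-- The dual code with respect to the standard inner product. -/
def dual (B : BinaryCode n) : BinaryCode n :=
  B.dualAnnihilator.comap (dotProductEquiv (ZMod 2) (Fin n)).toLinearMap

theorem mem_dual {B : BinaryCode n} {t : Fin n → ZMod 2} :
    t ∈ B.dual ↔ ∀ r ∈ B, t ⬝ᵥ r = 0 :=
  Submodule.mem_dualAnnihilator _

theorem mem_of_forall_mem_dual {B : BinaryCode n} {r : Fin n → ZMod 2}
    (h : ∀ t ∈ B.dual, t ⬝ᵥ r = 0) : r ∈ B := by
  refine (Subspace.forall_mem_dualAnnihilator_apply_eq_zero_iff B r).1 fun φ hφ => ?_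
  obtain ⟨t, rfl⟩ := (dotProductEquiv (ZMod 2) (Fin n)).surjective φ
  exact h t hφ

theorem mem_dual_span_range {κ : Type*} {g : κ → Fin n → ZMod 2} {t : Fin n → ZMod 2} :
    t ∈ dual (Submodule.span (ZMod 2) (Set.range g)) ↔ ∀ k, t ⬝ᵥ g k = 0 := by
  rw [mem_dual, ← Set.forall_mem_range (p := fun r => t ⬝ᵥ r = 0)]
  exact Submodule.span_le (p := LinearMap.ker (dotProductEquiv (ZMod 2) (Fin n) t))

theorem single_add_single_mem_dual {B : BinaryCode n} {i j : Fin n} :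
    Pi.single i 1 + Pi.single j 1 ∈ B.dual ↔ ∀ r ∈ B, r i = r j := by
  simp only [mem_dual, add_dotProduct, single_one_dotProduct, CharTwo.add_eq_zero]

end BinaryCode

namespace Z4Code

open BinaryCode

variable {n : ℕ}

/-- Multiplication by two, as a map `ℤ₂ → ℤ₄`. -/
def twice : ZMod 2 →+ ZMod 4 where
  toFun a := 2 * (a.val : ZMod 4)
  map_zero' := by decide
  map_add' := by decide

/-- Multiplication by two, as a map `ℤ₄ → ℤ₈`: it takes inner products to the polar form of the
Euclidean weight modulo `8`. -/
def twiceEight : ZMod 4 →+ ZMod 8 where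
  toFun a := 2 * (a.val : ZMod 8)
  map_zero' := by decide
  map_add' := by decide

/-- The word `2t` of `ℤ₄ⁿ` attached to a binary word `t`. -/
def double : (Fin n → ZMod 2) →+ (Fin n → ZMod 4) := twice.compLeft (Fin n)

instance ringHomSurjective_castHom :
    RingHomSurjective (ZMod.castHom (show 2 ∣ 4 by norm_num) (ZMod 2)) :=
  ⟨ZMod.castHom_surjective _⟩

/-- `reduceModTwo` as a semilinear map, so that residue codes are images of submodules. -/
def reduceLinear :
    (Fin n → ZMod 4) →ₛₗ[ZMod.castHom (show 2 ∣ 4 by norm_num) (ZMod 2)] (Fin n → ZMod 2) where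
  toFun := reduceModTwo
  map_add' _ _ := funext fun _ => map_add _ _ _
  map_smul' _ _ := funext fun _ => map_mul _ _ _

theorem reduceModTwo_add (x y : Fin n → ZMod 4) :
    reduceModTwo (x + y) = reduceModTwo x + reduceModTwo y := map_add reduceLinear x y

theorem reduceModTwo_sub (x y : Fin n → ZMod 4) :
    reduceModTwo (x - y) = reduceModTwo x - reduceModTwo y := map_sub reduceLinear x y

theorem reduceModTwo_double (t : Fin n → ZMod 2) : reduceModTwo (double t) = 0 := by
  have cast_twice : ∀ a, ZMod.castHom (show 2 ∣ 4 by norm_num) (ZMod 2) (twice a) = 0 := by decide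
  exact funext fun i => cast_twice (t i)

theorem exists_eq_double {x : Fin n → ZMod 4} (h : reduceModTwo x = 0) : ∃ t, x = double t := by
  have exists_twice : ∀ a : ZMod 4, ZMod.castHom (show 2 ∣ 4 by norm_num) (ZMod 2) a = 0 →
      ∃ b, a = twice b := by decide
  choose t ht using fun i => exists_twice (x i) (congrFun h i)
  exact ⟨t, funext ht⟩

theorem exists_eq_add_double {x y : Fin n → ZMod 4} (h : reduceModTwo x = reduceModTwo y) :
    ∃ t, x = y + double t := by
  obtain ⟨t, ht⟩ := exists_eq_double (x := x - y) (by rw [reduceModTwo_sub, h, sub_self])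
  exact ⟨t, by rw [← ht, add_sub_cancel]⟩

theorem twice_eq_zero : ∀ {a : ZMod 2}, twice a = 0 ↔ a = 0 := by decide

theorem twiceEight_eq_zero : ∀ {a : ZMod 4}, twiceEight a = 0 ↔ a = 0 := by decide

theorem double_eq_zero {t : Fin n → ZMod 2} : double t = 0 ↔ t = 0 :=
  ⟨fun h => funext fun i => twice_eq_zero.1 (congrFun h i), by rintro rfl; exact map_zero _⟩

theorem double_dotProduct (t : Fin n → ZMod 2) (x : Fin n → ZMod 4) :
    double t ⬝ᵥ x = twice (t ⬝ᵥ reduceModTwo x) := by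
  have twice_mul : ∀ (a : ZMod 2) (b : ZMod 4),
      twice a * b = twice (a * ZMod.castHom (show 2 ∣ 4 by norm_num) (ZMod 2) b) := by decide
  rw [dotProduct, dotProduct, map_sum]
  exact Finset.sum_congr rfl fun i _ => twice_mul (t i) (x i)

theorem dotProduct_double (x : Fin n → ZMod 4) (t : Fin n → ZMod 2) :
    x ⬝ᵥ double t = twice (t ⬝ᵥ reduceModTwo x) := by
  rw [dotProduct_comm, double_dotProduct]

section EuclideanWeight

theorem euclideanWeight_eq_sum (x : Fin n → ZMod 4) :
    euclideanWeight x = ∑ i, (x i).valMinAbs.natAbs ^ 2 := by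
  have sq_eq : ∀ a : ZMod 4, (if a = 1 then 1 else 0) + 4 * (if a = 2 then 1 else 0) +
      (if a = 3 then 1 else 0) = a.valMinAbs.natAbs ^ 2 := by decide
  simp only [euclideanWeight, countOf, Finset.card_filter, Finset.mul_sum,
    ← Finset.sum_add_distrib, sq_eq]

theorem euclideanWeight_eq_zero {x : Fin n → ZMod 4} : euclideanWeight x = 0 ↔ x = 0 := by
  simp [euclideanWeight_eq_sum, funext_iff]

theorem euclideanWeight_double (t : Fin n → ZMod 2) :
    euclideanWeight (double t) = 4 * hammingNorm t := by
  have sq_twice : ∀ a : ZMod 2, (twice a).valMinAbs.natAbs ^ 2 = 4 * a.val := by decide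
  rw [euclideanWeight_eq_sum, hammingNorm_eq_sum_val, Finset.mul_sum]
  exact Finset.sum_congr rfl fun i _ => sq_twice (t i)

theorem hammingNorm_reduceModTwo_le (x : Fin n → ZMod 4) :
    hammingNorm (reduceModTwo x) ≤ euclideanWeight x := by
  have val_le : ∀ a : ZMod 4, (ZMod.castHom (show 2 ∣ 4 by norm_num) (ZMod 2) a).val ≤
      a.valMinAbs.natAbs ^ 2 := by decide
  rw [euclideanWeight_eq_sum, hammingNorm_eq_sum_val]
  exact Finset.sum_le_sum fun i _ => val_le (x i)

theorem natCast_euclideanWeight_add (x y : Fin n → ZMod 4) :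
    (euclideanWeight (x + y) : ZMod 8) =
      euclideanWeight x + euclideanWeight y + twiceEight (x ⬝ᵥ y) := by
  have sq_add : ∀ a b : ZMod 4, (((a + b).valMinAbs.natAbs ^ 2 : ℕ) : ZMod 8) =
      (a.valMinAbs.natAbs ^ 2 : ℕ) + (b.valMinAbs.natAbs ^ 2 : ℕ) + twiceEight (a * b) := by
    decide
  simp only [euclideanWeight_eq_sum, dotProduct, Nat.cast_sum, map_sum, ← Finset.sum_add_distrib]
  exact Finset.sum_congr rfl fun i _ => sq_add (x i) (y i)

theorem eight_dvd_euclideanWeight_add_iff {x y : Fin n → ZMod 4} (hx : 8 ∣ euclideanWeight x)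
    (hy : 8 ∣ euclideanWeight y) : 8 ∣ euclideanWeight (x + y) ↔ x ⬝ᵥ y = 0 := by
  simp only [← ZMod.natCast_eq_zero_iff] at hx hy ⊢
  rw [natCast_euclideanWeight_add, hx, hy, add_zero, zero_add, twiceEight_eq_zero]

theorem eight_dvd_euclideanWeight_smul (a : ZMod 4) {x : Fin n → ZMod 4}
    (hx : 8 ∣ euclideanWeight x) : 8 ∣ euclideanWeight (a • x) := by
  have sq_mul : ∀ a b : ZMod 4, (((a * b).valMinAbs.natAbs ^ 2 : ℕ) : ZMod 8) =
      (a.valMinAbs.natAbs ^ 2 : ℕ) * (b.valMinAbs.natAbs ^ 2 : ℕ) := by decide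
  rw [← ZMod.natCast_eq_zero_iff, euclideanWeight_eq_sum, Nat.cast_sum] at hx ⊢
  simp only [Pi.smul_apply, smul_eq_mul, sq_mul, ← Finset.mul_sum, hx, mul_zero]

theorem natCast_euclideanWeight_double (t : Fin n → ZMod 2) :
    (euclideanWeight (double t) : ZMod 8) = twiceEight (twice (t ⬝ᵥ 1)) := by
  have sq_twice : ∀ a : ZMod 2, (((twice a).valMinAbs.natAbs ^ 2 : ℕ) : ZMod 8) =
      twiceEight (twice a) := by decide
  simp only [euclideanWeight_eq_sum, Nat.cast_sum, dotProduct_one, map_sum]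
  exact Finset.sum_congr rfl fun i _ => sq_twice (t i)

theorem eight_dvd_euclideanWeight_double_iff {t : Fin n → ZMod 2} :
    8 ∣ euclideanWeight (double t) ↔ t ⬝ᵥ 1 = 0 := by
  rw [← ZMod.natCast_eq_zero_iff, natCast_euclideanWeight_double, twiceEight_eq_zero,
    twice_eq_zero]

theorem eight_dvd_euclideanWeight_add_double_iff {x : Fin n → ZMod 4} {t : Fin n → ZMod 2}
    (hx : 8 ∣ euclideanWeight x) :
    8 ∣ euclideanWeight (x + double t) ↔ t ⬝ᵥ reduceModTwo x = t ⬝ᵥ 1 := by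
  rw [← ZMod.natCast_eq_zero_iff] at hx ⊢
  rw [natCast_euclideanWeight_add, hx, zero_add, natCast_euclideanWeight_double, ← map_add,
    dotProduct_double, ← map_add, twiceEight_eq_zero, twice_eq_zero, CharTwo.add_eq_zero, eq_comm]

end EuclideanWeight

section SelfDual

theorem mem_dual_iff {C : Z4Code n} {x : Fin n → ZMod 4} : x ∈ C.dual ↔ ∀ y ∈ C, x ⬝ᵥ y = 0 :=
  Iff.rfl

theorem IsSelfDual.dotProduct_eq_zero {C : Z4Code n} (hC : C.IsSelfDual) {x y : Fin n → ZMod 4}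
    (hx : x ∈ C) (hy : y ∈ C) : x ⬝ᵥ y = 0 :=
  mem_dual_iff.1 (hC ▸ hx) y hy

theorem double_mem_dual_iff {C : Z4Code n} {t : Fin n → ZMod 2} :
    double t ∈ C.dual ↔ t ∈ C.residue.dual := by
  simp only [mem_dual_iff, mem_dual, double_dotProduct, twice_eq_zero]
  exact ⟨by rintro h _ ⟨y, hy, rfl⟩; exact h y hy, fun h y hy => h _ ⟨y, hy, rfl⟩⟩

theorem IsSelfDual.double_mem_iff {C : Z4Code n} (hC : C.IsSelfDual) {t : Fin n → ZMod 2} :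
    double t ∈ C ↔ t ∈ C.residue.dual := by
  rw [← double_mem_dual_iff, ← hC]

/-- The words of a self-dual code that reduce to zero are determined by its residue code, so two
such codes are compared on lifts of the residue words alone. -/
theorem IsSelfDual.eq_of_le_of_residue_le {C D L : Z4Code n} (hC : C.IsSelfDual)
    (hD : D.IsSelfDual) (hLC : L ≤ C) (hLD : L ≤ D) (hres : C.residue = D.residue)
    (hL : C.residue ≤ L.residue) : C = D := by
  have le_of_le : ∀ {C D : Z4Code n}, C.IsSelfDual → D.IsSelfDual → L ≤ C → L ≤ D →
      C.residue = D.residue → C.residue ≤ L.residue → C ≤ D := by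
    intro C D hC hD hLC hLD hres hL x hx
    obtain ⟨y, hy, hyx⟩ := hL ⟨x, hx, rfl⟩
    obtain ⟨t, rfl⟩ := exists_eq_add_double hyx.symm
    have ht : double t ∈ C := (C.add_mem_iff_right (hLC hy)).1 hx
    rw [hC.double_mem_iff, hres, ← hD.double_mem_iff] at ht
    exact D.add_mem (hLD hy) ht
  exact le_antisymm (le_of_le hC hD hLC hLD hres hL)
    (le_of_le hD hC hLD hLC hres.symm (hres ▸ hL))

theorem IsTypeII.one_mem_residue {C : Z4Code n} (hC : C.IsTypeII) : 1 ∈ C.residue :=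
  mem_of_forall_mem_dual fun _ ht =>
    eight_dvd_euclideanWeight_double_iff.1 (hC.2 _ (hC.1.double_mem_iff.2 ht))

theorem residue_span (s : Set (Fin n → ZMod 4)) :
    residue (Submodule.span (ZMod 4) s) = Submodule.span (ZMod 2) (reduceModTwo '' s) :=
  Submodule.map_span reduceLinear s

end SelfDual

section Extension

/-- The words orthogonal to `L` whose reduction lies in the residue code of `L`. When `L` is
self-orthogonal, this is the self-dual code containing `L` with the same residue code. -/
def selfDualExtension (L : Z4Code n) : Z4Code n := L.residue.comap reduceLinear ⊓ L.dual

theorem mem_selfDualExtension {L : Z4Code n} {x : Fin n → ZMod 4} :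
    x ∈ selfDualExtension L ↔ reduceModTwo x ∈ L.residue ∧ x ∈ L.dual :=
  Iff.rfl

theorem le_selfDualExtension {L : Z4Code n} (hL : L ≤ L.dual) : L ≤ selfDualExtension L :=
  fun x hx => ⟨⟨x, hx, rfl⟩, hL hx⟩

theorem double_mem_selfDualExtension {L : Z4Code n} {t : Fin n → ZMod 2}
    (ht : t ∈ L.residue.dual) : double t ∈ selfDualExtension L := by
  rw [mem_selfDualExtension, reduceModTwo_double]
  exact ⟨zero_mem _, double_mem_dual_iff.2 ht⟩

theorem exists_eq_add_double_of_mem_selfDualExtension {L : Z4Code n} (hL : L ≤ L.dual)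
    {x : Fin n → ZMod 4} (hx : x ∈ selfDualExtension L) :
    ∃ y ∈ L, ∃ t ∈ L.residue.dual, x = y + double t := by
  obtain ⟨⟨y, hy, hyx⟩, hxL⟩ := mem_selfDualExtension.1 hx
  obtain ⟨t, rfl⟩ := exists_eq_add_double hyx.symm
  exact ⟨y, hy, t, double_mem_dual_iff.1 ((add_mem_cancel_left (hL hy)).1 hxL), rfl⟩

theorem residue_selfDualExtension {L : Z4Code n} (hL : L ≤ L.dual) :
    (selfDualExtension L).residue = L.residue := by
  refine le_antisymm ?_ (Submodule.map_mono (f := reduceLinear) (le_selfDualExtension hL))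
  rintro _ ⟨x, hx, rfl⟩
  exact hx.1

theorem isSelfDual_selfDualExtension {L : Z4Code n} (hL : L ≤ L.dual) :
    (selfDualExtension L).IsSelfDual := by
  refine le_antisymm (fun x hx z hz => ?_) fun x hx =>
    mem_selfDualExtension.2 ⟨mem_of_forall_mem_dual fun t ht => ?_, ?_⟩
  · change x ⬝ᵥ z = 0
    obtain ⟨y, hy, t, ht, rfl⟩ := exists_eq_add_double_of_mem_selfDualExtension hL hx
    obtain ⟨hzres, hzdual⟩ := mem_selfDualExtension.1 hz
    rw [add_dotProduct, double_dotProduct, mem_dual.1 ht _ hzres, map_zero, add_zero,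
      dotProduct_comm, mem_dual_iff.1 hzdual y hy]
  · rw [← twice_eq_zero, ← dotProduct_double]
    exact hx _ (double_mem_selfDualExtension ht)
  · exact fun y hy => hx y (le_selfDualExtension hL hy)

theorem isTypeII_selfDualExtension {L : Z4Code n} (hL : L ≤ L.dual)
    (h8 : ∀ x ∈ L, 8 ∣ euclideanWeight x) (hone : 1 ∈ L.residue) :
    (selfDualExtension L).IsTypeII := by
  refine ⟨isSelfDual_selfDualExtension hL, fun x hx => ?_⟩
  obtain ⟨y, hy, t, ht, rfl⟩ := exists_eq_add_double_of_mem_selfDualExtension hL hx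
  rw [eight_dvd_euclideanWeight_add_double_iff (h8 y hy), mem_dual.1 ht _ ⟨y, hy, rfl⟩,
    mem_dual.1 ht 1 hone]

theorem span_le_dual_span {s : Set (Fin n → ZMod 4)} (hs : ∀ x ∈ s, ∀ y ∈ s, x ⬝ᵥ y = 0) :
    Submodule.span (ZMod 4) s ≤ dual (Submodule.span (ZMod 4) s) := by
  intro x hx y hy
  induction hx, hy using Submodule.span_induction₂ with
  | mem_mem x y hx hy => exact hs x hx y hy
  | zero_left y _ => exact zero_dotProduct y
  | zero_right x _ => exact dotProduct_zero x
  | add_left x y z _ _ _ hx hy =>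
    exact (add_dotProduct x y z).trans (by simp [dotProduct, hx, hy])
  | add_right x y z _ _ _ hx hy =>
    exact (dotProduct_add x y z).trans (by simp [dotProduct, hx, hy])
  | smul_left a x y _ _ h => exact (smul_dotProduct a x y).trans (by simp [dotProduct, h])
  | smul_right a x y _ _ h => exact (dotProduct_smul a x y).trans (by simp [dotProduct, h])

theorem eight_dvd_euclideanWeight_of_mem_span {s : Set (Fin n → ZMod 4)}
    (hs : ∀ x ∈ s, ∀ y ∈ s, x ⬝ᵥ y = 0) (h8 : ∀ x ∈ s, 8 ∣ euclideanWeight x)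
    {x : Fin n → ZMod 4} (hx : x ∈ Submodule.span (ZMod 4) s) : 8 ∣ euclideanWeight x := by
  induction hx using Submodule.span_induction with
  | mem x hx => exact h8 x hx
  | zero => rw [euclideanWeight_eq_zero.2 rfl]; exact dvd_zero 8
  | add x y hx hy hx8 hy8 =>
    exact (eight_dvd_euclideanWeight_add_iff hx8 hy8).2 (span_le_dual_span hs hx y hy)
  | smul a x _ hx8 => exact eight_dvd_euclideanWeight_smul a hx8

end Extension

section TriplyEven

/-- The word of `ℤ₄ⁿ` with entries `0` and `1` that reduces to a given binary word. -/
def zeroOneLift (r : Fin n → ZMod 2) : Fin n → ZMod 4 := fun i => (r i).val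

theorem reduceModTwo_zeroOneLift (r : Fin n → ZMod 2) : reduceModTwo (zeroOneLift r) = r := by
  have cast_val : ∀ a : ZMod 2,
      ZMod.castHom (show 2 ∣ 4 by norm_num) (ZMod 2) (a.val : ZMod 4) = a := by decide
  exact funext fun i => cast_val (r i)

theorem zeroOneLift_dotProduct_zeroOneLift (r s : Fin n → ZMod 2) :
    zeroOneLift r ⬝ᵥ zeroOneLift s = hammingNorm (r * s) := by
  have val_mul : ∀ a b : ZMod 2, (a.val : ZMod 4) * b.val = ((a * b).val : ℕ) := by decide
  rw [hammingNorm_eq_sum_val, Nat.cast_sum]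
  exact Finset.sum_congr rfl fun i _ => val_mul (r i) (s i)

theorem euclideanWeight_zeroOneLift (r : Fin n → ZMod 2) :
    euclideanWeight (zeroOneLift r) = hammingNorm r := by
  have sq_val : ∀ a : ZMod 2, (a.val : ZMod 4).valMinAbs.natAbs ^ 2 = a.val := by decide
  rw [euclideanWeight_eq_sum, hammingNorm_eq_sum_val]
  exact Finset.sum_congr rfl fun i _ => sq_val (r i)

theorem exists_isTypeII_residue_eq {B : BinaryCode n} (hone : 1 ∈ B)
    (h8 : ∀ r ∈ B, 8 ∣ hammingNorm r) : ∃ C : Z4Code n, C.IsTypeII ∧ C.residue = B := by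
  set s : Set (Fin n → ZMod 4) := zeroOneLift '' B
  have hres : residue (Submodule.span (ZMod 4) s) = B := by
    simp only [s, residue_span, Set.image_image, reduceModTwo_zeroOneLift, Set.image_id',
      Submodule.span_eq]
  have hdot : ∀ x ∈ s, ∀ y ∈ s, x ⬝ᵥ y = 0 := by
    rintro _ ⟨r, hr, rfl⟩ _ ⟨t, ht, rfl⟩
    rw [zeroOneLift_dotProduct_zeroOneLift, ZMod.natCast_eq_zero_iff]
    exact four_dvd_hammingNorm_mul (h8 r hr) (h8 t ht) (h8 _ (B.add_mem hr ht))
  have hwt : ∀ x ∈ s, 8 ∣ euclideanWeight x := by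
    rintro _ ⟨r, hr, rfl⟩
    rw [euclideanWeight_zeroOneLift]
    exact h8 r hr
  have hself := span_le_dual_span hdot
  refine ⟨selfDualExtension (.span (ZMod 4) s), isTypeII_selfDualExtension hself ?_ ?_, ?_⟩
  · exact fun _ => eight_dvd_euclideanWeight_of_mem_span hdot hwt
  · rwa [hres]
  · rw [residue_selfDualExtension hself, hres]

end TriplyEven

section SignedPermutation

theorem units_mul_self (e : ℤˣ) : ((e : ℤ) : ZMod 4) * ((e : ℤ) : ZMod 4) = 1 := by
  rw [← Int.cast_mul, ← Units.val_mul, Int.units_mul_self, Units.val_one, Int.cast_one]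

/-- The action of a permutation and of sign changes of the coordinates on `ℤ₄ⁿ`. -/
def signedPerm (σ : Equiv.Perm (Fin n)) (ε : Fin n → ℤˣ) :
    (Fin n → ZMod 4) →ₗ[ZMod 4] (Fin n → ZMod 4) where
  toFun x i := ((ε i : ℤ) : ZMod 4) * x (σ i)
  map_add' _ _ := funext fun _ => mul_add _ _ _
  map_smul' _ _ := funext fun _ => mul_left_comm _ _ _

theorem signedPerm_apply (σ : Equiv.Perm (Fin n)) (ε : Fin n → ℤˣ) (x : Fin n → ZMod 4)
    (i : Fin n) : signedPerm σ ε x i = ((ε i : ℤ) : ZMod 4) * x (σ i) := rfl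

theorem signedPerm_signedPerm (σ τ : Equiv.Perm (Fin n)) (ε δ : Fin n → ℤˣ)
    (x : Fin n → ZMod 4) :
    signedPerm σ ε (signedPerm τ δ x) = signedPerm (τ * σ) (ε * δ ∘ σ) x := by
  funext i
  simp [signedPerm_apply, mul_assoc]

theorem signedPerm_symm_apply_signedPerm (σ : Equiv.Perm (Fin n)) (ε : Fin n → ℤˣ)
    (x : Fin n → ZMod 4) : signedPerm σ.symm (ε ∘ σ.symm) (signedPerm σ ε x) = x := by
  funext i
  simp [signedPerm_apply, ← mul_assoc, units_mul_self]

theorem signedPerm_surjective (σ : Equiv.Perm (Fin n)) (ε : Fin n → ℤˣ) :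
    Function.Surjective (signedPerm σ ε) :=
  Finite.surjective_of_injective
    (Function.LeftInverse.injective (g := signedPerm σ.symm (ε ∘ σ.symm))
      (signedPerm_symm_apply_signedPerm σ ε))

theorem signedPerm_dotProduct_signedPerm (σ : Equiv.Perm (Fin n)) (ε : Fin n → ℤˣ)
    (x y : Fin n → ZMod 4) : signedPerm σ ε x ⬝ᵥ signedPerm σ ε y = x ⬝ᵥ y := by
  rw [← comp_equiv_dotProduct_comp_equiv x y σ]
  refine Finset.sum_congr rfl fun i _ => ?_
  rw [signedPerm_apply, signedPerm_apply, mul_mul_mul_comm, units_mul_self, one_mul]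
  rfl

theorem euclideanWeight_signedPerm (σ : Equiv.Perm (Fin n)) (ε : Fin n → ℤˣ)
    (x : Fin n → ZMod 4) : euclideanWeight (signedPerm σ ε x) = euclideanWeight x := by
  have sq_units_mul (e : ℤˣ) (a : ZMod 4) :
      (((e : ℤ) : ZMod 4) * a).valMinAbs.natAbs = a.valMinAbs.natAbs := by
    rcases Int.units_eq_one_or e with rfl | rfl <;> simp [ZMod.natAbs_valMinAbs_neg]
  simp only [euclideanWeight_eq_sum, signedPerm_apply, sq_units_mul]
  exact Equiv.sum_comp σ fun i => (x i).valMinAbs.natAbs ^ 2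

theorem reduceModTwo_signedPerm (σ : Equiv.Perm (Fin n)) (ε : Fin n → ℤˣ)
    (x : Fin n → ZMod 4) : reduceModTwo (signedPerm σ ε x) = reduceModTwo x ∘ σ := by
  funext i
  rw [reduceModTwo, signedPerm_apply, map_mul, map_intCast]
  rcases Int.units_eq_one_or (ε i) with h | h <;> rw [h] <;> exact one_mul _

theorem residue_map_signedPerm (C : Z4Code n) (σ : Equiv.Perm (Fin n)) (ε : Fin n → ℤˣ) :
    residue (C.map (signedPerm σ ε)) = C.residue.map (LinearMap.funLeft (ZMod 2) (ZMod 2) σ) := by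
  refine SetLike.coe_injective ?_
  change reduceModTwo '' (signedPerm σ ε '' C) = (· ∘ σ) '' (reduceModTwo '' C)
  simp only [Set.image_image, reduceModTwo_signedPerm]

theorem equivalent_map_signedPerm (C : Z4Code n) (σ : Equiv.Perm (Fin n)) (ε : Fin n → ℤˣ) :
    Equivalent C (C.map (signedPerm σ ε)) :=
  ⟨σ, ε, rfl⟩

theorem equivalent_iff {C D : Z4Code n} :
    Equivalent C D ↔ ∃ σ ε, D = C.map (signedPerm σ ε) := by
  simp only [← SetLike.coe_set_eq (q := Submodule.map _ _)]
  rfl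

theorem Equivalent.symm {C D : Z4Code n} (h : Equivalent C D) : Equivalent D C := by
  obtain ⟨σ, ε, rfl⟩ := equivalent_iff.1 h
  refine equivalent_iff.2 ⟨σ.symm, ε ∘ σ.symm, SetLike.coe_injective ?_⟩
  simp [Set.image_image, signedPerm_symm_apply_signedPerm]

theorem Equivalent.trans {C D E : Z4Code n} (hCD : Equivalent C D) (hDE : Equivalent D E) :
    Equivalent C E := by
  obtain ⟨τ, δ, rfl⟩ := equivalent_iff.1 hCD
  obtain ⟨σ, ε, rfl⟩ := equivalent_iff.1 hDE
  refine equivalent_iff.2 ⟨τ * σ, ε * δ ∘ σ, SetLike.coe_injective ?_⟩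
  simp [Set.image_image, signedPerm_signedPerm]

theorem IsSelfDual.map_signedPerm {C : Z4Code n} (hC : C.IsSelfDual) (σ : Equiv.Perm (Fin n))
    (ε : Fin n → ℤˣ) : IsSelfDual (C.map (signedPerm σ ε)) := by
  refine le_antisymm ?_ fun z hz => ?_
  · rintro _ ⟨x, hx, rfl⟩ _ ⟨y, hy, rfl⟩
    exact (signedPerm_dotProduct_signedPerm σ ε x y).trans (hC.dotProduct_eq_zero hx hy)
  · obtain ⟨x, rfl⟩ := signedPerm_surjective σ ε z
    refine ⟨x, hC ▸ mem_dual_iff.2 fun y hy => ?_, rfl⟩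
    rw [← signedPerm_dotProduct_signedPerm σ ε]
    exact hz _ ⟨y, hy, rfl⟩

theorem IsTypeII.map_signedPerm {C : Z4Code n} (hC : C.IsTypeII) (σ : Equiv.Perm (Fin n))
    (ε : Fin n → ℤˣ) : IsTypeII (C.map (signedPerm σ ε)) := by
  refine ⟨hC.1.map_signedPerm σ ε, ?_⟩
  rintro _ ⟨x, hx, rfl⟩
  rw [euclideanWeight_signedPerm]
  exact hC.2 x hx

end SignedPermutation

section SignChange

/-- The sign changes at the support of the binary word `S`. -/
def signChange (S : Fin n → ZMod 2) : Fin n → ℤˣ := fun i => if S i = 0 then 1 else -1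

theorem signedPerm_one_signChange (S : Fin n → ZMod 2) (x : Fin n → ZMod 4) :
    signedPerm 1 (signChange S) x = x + double (S * reduceModTwo x) := by
  have sign_mul : ∀ (a : ZMod 2) (b : ZMod 4),
      (((if a = 0 then 1 else -1 : ℤˣ) : ℤ) : ZMod 4) * b =
        b + twice (a * ZMod.castHom (show 2 ∣ 4 by norm_num) (ZMod 2) b) := by decide
  exact funext fun i => sign_mul (S i) (x i)

theorem residue_map_signedPerm_one (C : Z4Code n) (ε : Fin n → ℤˣ) :
    residue (C.map (signedPerm 1 ε)) = C.residue :=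
  (residue_map_signedPerm C 1 ε).trans (Submodule.map_id _)

theorem IsSelfDual.dotProduct_reduceModTwo_comm {C D : Z4Code n} (hC : C.IsSelfDual)
    (hD : D.IsSelfDual) {x y : Fin n → ZMod 4} {u v : Fin n → ZMod 2} (hx : x ∈ C) (hy : y ∈ C)
    (hxu : x + double u ∈ D) (hyv : y + double v ∈ D) :
    u ⬝ᵥ reduceModTwo y = v ⬝ᵥ reduceModTwo x := by
  have h := hD.dotProduct_eq_zero hxu hyv
  rw [add_dotProduct, dotProduct_add, hC.dotProduct_eq_zero hx hy, zero_add, dotProduct_double,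
    double_dotProduct, reduceModTwo_add, reduceModTwo_double, add_zero, ← map_add, twice_eq_zero,
    CharTwo.add_eq_zero] at h
  exact h.symm

variable {ι : Type*} {g : ι → Fin n → ZMod 2} {C D : Z4Code n}

theorem IsSelfDual.add_double_mem_iff (hC : C.IsSelfDual)
    (hres : C.residue = Submodule.span (ZMod 2) (Set.range g)) {x : Fin n → ZMod 4} (hx : x ∈ C)
    {t : Fin n → ZMod 2} : x + double t ∈ C ↔ ∀ k, t ⬝ᵥ g k = 0 := by
  rw [C.add_mem_iff_right hx, hC.double_mem_iff, hres, mem_dual_span_range]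

theorem IsSelfDual.eq_of_common_lifts (hC : C.IsSelfDual) (hD : D.IsSelfDual)
    (hCres : C.residue = Submodule.span (ZMod 2) (Set.range g)) (hres : C.residue = D.residue)
    (h : ∀ k, ∃ x ∈ C, x ∈ D ∧ reduceModTwo x = g k) : C = D := by
  choose x hxC hxD hxg using h
  refine hC.eq_of_le_of_residue_le hD (L := .span (ZMod 4) (Set.range x)) ?_ ?_ hres ?_
  · exact Submodule.span_le.2 (Set.range_subset_iff.2 hxC)
  · exact Submodule.span_le.2 (Set.range_subset_iff.2 hxD)
  · rw [residue_span, ← Set.range_comp, hCres]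
    exact (congrArg (fun r => Submodule.span (ZMod 2) (Set.range r)) (funext hxg)).ge

/-- Lifts of the generators `g k` to `C` and to `D` differ by doubled words `u k`. Since both codes
are Type II, the matrix `u k ⬝ᵥ g l` is symmetric with diagonal equal to its row at `k₀`; a sign
change realising that matrix takes `C` to `D`. -/
theorem IsTypeII.exists_eq_map_signedPerm {k₀ : ι} (hone : g k₀ = 1)
    (hsolve : ∀ β : ι → ι → ZMod 2, (∀ k l, β k l = β l k) → (∀ k, β k k = β k₀ k) →
      ∃ S : Fin n → ZMod 2, ∀ k l, S ⬝ᵥ (g k * g l) = β k l)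
    (hC : C.IsTypeII) (hD : D.IsTypeII)
    (hCres : C.residue = Submodule.span (ZMod 2) (Set.range g)) (hres : C.residue = D.residue) :
    ∃ S, D = C.map (signedPerm 1 (signChange S)) := by
  have hgC (k : ι) : g k ∈ C.residue := hCres ▸ Submodule.subset_span ⟨k, rfl⟩
  have hgD (k : ι) : g k ∈ D.residue := hres ▸ hgC k
  choose c hcC hcg using hgC
  choose d hdD hdg using hgD
  choose u hu using fun k => exists_eq_add_double ((hdg k).trans (hcg k).symm)
  have hcuD (k : ι) : c k + double (u k) ∈ D := hu k ▸ hdD k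
  have gram_comm (k l : ι) : u k ⬝ᵥ g l = u l ⬝ᵥ g k := by
    rw [← hcg k, ← hcg l]
    exact hC.1.dotProduct_reduceModTwo_comm hD.1 (hcC k) (hcC l) (hcuD k) (hcuD l)
  have gram_diag (k : ι) : u k ⬝ᵥ g k = u k₀ ⬝ᵥ g k := by
    rw [gram_comm k₀ k, hone, ← hcg k]
    exact (eight_dvd_euclideanWeight_add_double_iff (hC.2 _ (hcC k))).1 (hD.2 _ (hcuD k))
  obtain ⟨S, hS⟩ := hsolve (fun k l => u k ⬝ᵥ g l) gram_comm gram_diag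
  refine ⟨S, hD.1.eq_of_common_lifts (hC.1.map_signedPerm 1 _) (hres ▸ hCres) ?_ fun k =>
    ⟨d k, hdD k, ?_, hdg k⟩⟩
  · rw [residue_map_signedPerm_one, hres]
  have hmem : c k + double (S * g k) ∈ C.map (signedPerm 1 (signChange S)) :=
    ⟨c k, hcC k, by rw [← hcg k]; exact signedPerm_one_signChange S (c k)⟩
  have hdiff : d k = c k + double (S * g k) + double (u k - S * g k) := by
    rw [add_assoc, ← map_add, add_sub_cancel, hu k]
  rw [hdiff, (hC.1.map_signedPerm 1 _).add_double_mem_iff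
    ((residue_map_signedPerm_one C _).trans hCres) hmem]
  intro l
  have mul_dotProduct : (S * g k) ⬝ᵥ g l = S ⬝ᵥ (g k * g l) := by
    simp only [dotProduct, Pi.mul_apply, mul_assoc]
  rw [sub_dotProduct, mul_dotProduct, hS, sub_self]

end SignChange

section MinimumWeight

variable {C : Z4Code n}

theorem IsSelfDual.separatesPoints_residue (hC : C.IsSelfDual) (h : 8 < C.minEuclideanWeight) :
    (C.residue : Set (Fin n → ZMod 2)).SeparatesPoints := by
  intro i j hij
  by_contra! hsep
  have hne : (Pi.single i 1 + Pi.single j 1 : Fin n → ZMod 2) ≠ 0 := fun h0 => by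
    simpa [hij] using congrFun h0 i
  have hmin : C.minEuclideanWeight ≤
      euclideanWeight (double (Pi.single i 1 + Pi.single j 1 : Fin n → ZMod 2)) :=
    Nat.sInf_le ⟨_, hC.double_mem_iff.2 (single_add_single_mem_dual.2 hsep),
      double_eq_zero.not.2 hne, rfl⟩
  have hle := hammingNorm_add_le (Pi.single i 1) (Pi.single j 1 : Fin n → ZMod 2)
  rw [hammingNorm_single, hammingNorm_single] at hle
  rw [euclideanWeight_double] at hmin
  lia

theorem IsTypeII.sixteen_le_euclideanWeight_double (hC : C.IsTypeII)
    (hsep : (C.residue : Set (Fin n → ZMod 2)).SeparatesPoints) {t : Fin n → ZMod 2}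
    (ht : double t ∈ C) (ht0 : t ≠ 0) : 16 ≤ euclideanWeight (double t) := by
  have h8 := hC.2 _ ht
  have h0 : hammingNorm t ≠ 0 := hammingNorm_ne_zero_iff.2 ht0
  have h2 : hammingNorm t ≠ 2 := fun h => by
    obtain ⟨i, j, hij, rfl⟩ := exists_eq_single_add_single h
    obtain ⟨r, hr, hne⟩ := hsep hij
    exact hne (single_add_single_mem_dual.1 (hC.1.double_mem_iff.1 ht) r hr)
  rw [euclideanWeight_double] at h8 ⊢
  lia

theorem IsTypeII.minEuclideanWeight_eq_sixteen (hC : C.IsTypeII)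
    (hsep : (C.residue : Set (Fin n → ZMod 2)).SeparatesPoints)
    (hres : ∀ r ∈ C.residue, r ≠ 0 → 16 ≤ hammingNorm r) {t : Fin n → ZMod 2}
    (ht : t ∈ C.residue.dual) (ht0 : t ≠ 0) (ht4 : hammingNorm t ≤ 4) :
    C.minEuclideanWeight = 16 := by
  have htC := hC.1.double_mem_iff.2 ht
  have hle : euclideanWeight (double t) ≤ 16 := by
    rw [euclideanWeight_double]
    lia
  refine IsLeast.csInf_eq ⟨⟨double t, htC, double_eq_zero.not.2 ht0,
    hle.antisymm (hC.sixteen_le_euclideanWeight_double hsep htC ht0)⟩, ?_⟩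
  rintro _ ⟨x, hx, hx0, rfl⟩
  by_cases hxres : reduceModTwo x = 0
  · obtain ⟨s, rfl⟩ := exists_eq_double hxres
    exact hC.sixteen_le_euclideanWeight_double hsep hx (double_eq_zero.not.1 hx0)
  · exact (hres _ ⟨x, hx, rfl⟩ hxres).trans (hammingNorm_reduceModTwo_le x)

end MinimumWeight

end Z4Code

namespace BinaryCode

section ReedMuller

variable {m n : ℕ}

/-- The generators `1, X₁, …, Xₘ` of the first order Reed–Muller code whose positions are labelled
by the points of `𝔽₂ᵐ`. -/
def reedMullerGenerator (x : Fin n ≃ (Fin m → ZMod 2)) : Fin (m + 1) → Fin n → ZMod 2 :=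
  Fin.cons 1 fun j p => x p j

/-- The first order Reed–Muller code `RM(1, m)`, for a labelling of the positions by the points of
`𝔽₂ᵐ`. -/
def reedMuller (x : Fin n ≃ (Fin m → ZMod 2)) : BinaryCode n :=
  Submodule.span (ZMod 2) (Set.range (reedMullerGenerator x))

/-- The word of the affine function `a + v₁X₁ + ⋯ + vₘXₘ`. -/
def affineWord (x : Fin n ≃ (Fin m → ZMod 2)) (a : ZMod 2) (v : Fin m → ZMod 2) :
    Fin n → ZMod 2 :=
  fun p => a + v ⬝ᵥ x p

theorem sum_smul_reedMullerGenerator (x : Fin n ≃ (Fin m → ZMod 2)) (c : Fin (m + 1) → ZMod 2) :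
    ∑ k, c k • reedMullerGenerator x k = affineWord x (c 0) (Fin.tail c) := by
  funext p
  simp [Fin.sum_univ_succ, reedMullerGenerator, affineWord, dotProduct, Fin.tail]

theorem exists_affineWord_eq {x : Fin n ≃ (Fin m → ZMod 2)} {r : Fin n → ZMod 2}
    (hr : r ∈ reedMuller x) : ∃ a v, affineWord x a v = r := by
  obtain ⟨c, rfl⟩ := (Submodule.mem_span_range_iff_exists_fun (ZMod 2)).1 hr
  exact ⟨c 0, Fin.tail c, (sum_smul_reedMullerGenerator x c).symm⟩

theorem reedMullerGenerator_mem (x : Fin n ≃ (Fin m → ZMod 2)) (k : Fin (m + 1)) :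
    reedMullerGenerator x k ∈ reedMuller x :=
  Submodule.subset_span ⟨k, rfl⟩

theorem linearIndependent_reedMullerGenerator (x : Fin n ≃ (Fin m → ZMod 2)) :
    LinearIndependent (ZMod 2) (reedMullerGenerator x) := by
  refine Fintype.linearIndependent_iff.2 fun c hc => ?_
  rw [sum_smul_reedMullerGenerator] at hc
  have eval_eq_zero (w : Fin m → ZMod 2) : c 0 + Fin.tail c ⬝ᵥ w = 0 := by
    simpa [affineWord] using congrFun hc (x.symm w)
  have h0 : c 0 = 0 := by simpa using eval_eq_zero 0
  refine Fin.cases h0 fun j => ?_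
  simpa [h0, Fin.tail] using eval_eq_zero (Pi.single j 1)

theorem finrank_reedMuller (x : Fin n ≃ (Fin m → ZMod 2)) :
    Module.finrank (ZMod 2) (reedMuller x) = m + 1 := by
  rw [reedMuller, finrank_span_eq_card (linearIndependent_reedMullerGenerator x),
    Fintype.card_fin]

theorem separatesPoints_reedMuller (x : Fin n ≃ (Fin m → ZMod 2)) :
    (reedMuller x : Set (Fin n → ZMod 2)).SeparatesPoints := by
  intro p q hpq
  obtain ⟨j, hj⟩ := Function.ne_iff.1 (x.injective.ne hpq)
  exact ⟨_, reedMullerGenerator_mem x j.succ, hj⟩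

theorem length_eq_two_pow (x : Fin n ≃ (Fin m → ZMod 2)) : n = 2 ^ m := by
  simpa using Fintype.card_congr x

/-- A translation of `𝔽₂ᵐ` that changes the value of a nonconstant affine function exchanges its
zeros with its ones. -/
theorem two_mul_hammingNorm_affineWord (x : Fin n ≃ (Fin m → ZMod 2)) (a : ZMod 2)
    {v : Fin m → ZMod 2} (hv : v ≠ 0) : 2 * hammingNorm (affineWord x a v) = 2 ^ m := by
  obtain ⟨j, hj⟩ := Function.ne_iff.1 hv
  have hj1 : v j = 1 := Fin.eq_one_of_ne_zero (v j) hj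
  let σ : Equiv.Perm (Fin n) := (x.trans (Equiv.addRight (Pi.single j 1))).trans x.symm
  have hσ : affineWord x a v ∘ σ = affineWord x a v + 1 := by
    funext p
    simp [affineWord, σ, hj1, add_assoc]
  rw [two_mul_hammingNorm_of_comp_eq_add_one hσ, Fintype.card_fin, length_eq_two_pow x]

theorem two_pow_dvd_two_mul_hammingNorm_of_mem_reedMuller {x : Fin n ≃ (Fin m → ZMod 2)}
    {r : Fin n → ZMod 2} (hr : r ∈ reedMuller x) : 2 ^ m ∣ 2 * hammingNorm r := by
  obtain ⟨a, v, rfl⟩ := exists_affineWord_eq hr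
  rcases eq_or_ne v 0 with rfl | hv
  · have hconst : affineWord x a 0 = fun _ => a := by
      funext p
      simp [affineWord]
    rw [hconst, hammingNorm_eq_sum_val, Finset.sum_const, Finset.card_fin, length_eq_two_pow x,
      smul_eq_mul]
    exact (dvd_mul_right _ _).mul_left 2
  · exact (two_mul_hammingNorm_affineWord x a hv).symm.dvd

theorem sixteen_dvd_hammingNorm_of_mem_reedMuller (hm : 5 ≤ m) {x : Fin n ≃ (Fin m → ZMod 2)}
    {r : Fin n → ZMod 2} (hr : r ∈ reedMuller x) : 16 ∣ hammingNorm r := by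
  have h32 : 2 ^ 5 ∣ 2 * hammingNorm r :=
    (pow_dvd_pow 2 hm).trans (two_pow_dvd_two_mul_hammingNorm_of_mem_reedMuller hr)
  lia

/-- The characteristic word of the position labelled `w`; its inner product with a word `r` is the
value of `r` at that position. -/
def pointWord (x : Fin n ≃ (Fin m → ZMod 2)) (w : Fin m → ZMod 2) : Fin n → ZMod 2 :=
  Pi.single (x.symm w) 1

theorem pointWord_dotProduct (x : Fin n ≃ (Fin m → ZMod 2)) (w : Fin m → ZMod 2)
    (r : Fin n → ZMod 2) : pointWord x w ⬝ᵥ r = r (x.symm w) :=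
  single_one_dotProduct _ _

theorem reedMullerGenerator_zero (x : Fin n ≃ (Fin m → ZMod 2)) :
    reedMullerGenerator x 0 = 1 := rfl

theorem reedMullerGenerator_succ_symm (x : Fin n ≃ (Fin m → ZMod 2)) (j : Fin m)
    (w : Fin m → ZMod 2) : reedMullerGenerator x j.succ (x.symm w) = w j :=
  congrFun (x.apply_symm_apply w) j

/-- The characteristic word of the plane spanned by the unit vectors `eᵢ` and `eⱼ`, for `i ≠ j`. -/
def planeWord (x : Fin n ≃ (Fin m → ZMod 2)) (i j : Fin m) : Fin n → ZMod 2 :=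
  pointWord x 0 + pointWord x (Pi.single i 1) + pointWord x (Pi.single j 1) +
    pointWord x (Pi.single i 1 + Pi.single j 1)

theorem planeWord_dotProduct_generator (x : Fin n ≃ (Fin m → ZMod 2)) (i j : Fin m)
    (k : Fin (m + 1)) : planeWord x i j ⬝ᵥ reedMullerGenerator x k = 0 := by
  simp only [planeWord, add_dotProduct, pointWord_dotProduct]
  refine Fin.cases rfl (fun k => ?_) k
  simp only [reedMullerGenerator_succ_symm, Pi.zero_apply, zero_add, Pi.add_apply,
    CharTwo.add_self_eq_zero]

theorem planeWord_mem_dual (x : Fin n ≃ (Fin m → ZMod 2)) (i j : Fin m) :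
    planeWord x i j ∈ (reedMuller x).dual :=
  mem_dual_span_range.2 (planeWord_dotProduct_generator x i j)

theorem planeWord_dotProduct_generator_mul (x : Fin n ≃ (Fin m → ZMod 2)) (i j k l : Fin m) :
    planeWord x i j ⬝ᵥ (reedMullerGenerator x k.succ * reedMullerGenerator x l.succ) =
      (Pi.single i 1 : Fin m → ZMod 2) k * (Pi.single j 1 : Fin m → ZMod 2) l +
        (Pi.single j 1 : Fin m → ZMod 2) k * (Pi.single i 1 : Fin m → ZMod 2) l := by
  have polar : ∀ a b c d : ZMod 2, 0 * 0 + a * b + c * d + (a + c) * (b + d) = a * d + c * b := by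
    decide
  simp only [planeWord, add_dotProduct, pointWord_dotProduct, Pi.mul_apply,
    reedMullerGenerator_succ_symm, Pi.add_apply, Pi.zero_apply, polar]

theorem planeWord_ne_zero (x : Fin n ≃ (Fin m → ZMod 2)) {i j : Fin m} (hij : i ≠ j) :
    planeWord x i j ≠ 0 := fun h => by
  have := planeWord_dotProduct_generator_mul x i j i j
  simp [h, hij] at this

theorem hammingNorm_planeWord_le (x : Fin n ≃ (Fin m → ZMod 2)) (i j : Fin m) :
    hammingNorm (planeWord x i j) ≤ 4 := by
  have hpoint (w : Fin m → ZMod 2) : hammingNorm (pointWord x w) = 1 := hammingNorm_single _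
  have h₂ := hammingNorm_add_le (pointWord x 0) (pointWord x (Pi.single i 1))
  have h₃ := hammingNorm_add_le (pointWord x 0 + pointWord x (Pi.single i 1))
    (pointWord x (Pi.single j 1))
  have h₄ := hammingNorm_add_le (pointWord x 0 + pointWord x (Pi.single i 1) +
    pointWord x (Pi.single j 1)) (pointWord x (Pi.single i 1 + Pi.single j 1))
  simp only [hpoint] at h₂ h₃ h₄
  exact h₄.trans (by lia)

/-- The products of two generators are the monomials of degree at most two, which are linearly
independent apart from `1 · Xₖ = Xₖ · Xₖ`. The word `S` below is read off the dual basis: points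
determine the constant and linear terms, planes the quadratic ones. -/
theorem exists_dotProduct_generator_mul_generator (x : Fin n ≃ (Fin m → ZMod 2))
    (β : Fin (m + 1) → Fin (m + 1) → ZMod 2) (hsymm : ∀ k l, β k l = β l k)
    (hdiag : ∀ k, β k k = β 0 k) :
    ∃ S, ∀ k l, S ⬝ᵥ (reedMullerGenerator x k * reedMullerGenerator x l) = β k l := by
  let S : Fin n → ZMod 2 := β 0 0 • pointWord x 0 +
    ∑ i : Fin m, β 0 i.succ • (pointWord x (Pi.single i 1) + pointWord x 0) +
    ∑ i : Fin m, ∑ j : Fin m, (if i < j then β i.succ j.succ else 0) • planeWord x i j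
  have hzero (l : Fin (m + 1)) : S ⬝ᵥ reedMullerGenerator x l = β 0 l := by
    simp only [S, add_dotProduct, sum_dotProduct, smul_dotProduct, pointWord_dotProduct,
      planeWord_dotProduct_generator, smul_zero, Finset.sum_const_zero, add_zero]
    refine Fin.cases ?_ (fun l => ?_) l
    · simp [reedMullerGenerator_zero, CharTwo.add_self_eq_zero]
    · simp [reedMullerGenerator_succ_symm, Pi.single_apply]
  have hsucc (k l : Fin m) :
      S ⬝ᵥ (reedMullerGenerator x k.succ * reedMullerGenerator x l.succ) = β k.succ l.succ := by
    simp only [S, add_dotProduct, sum_dotProduct, smul_dotProduct, pointWord_dotProduct,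
      planeWord_dotProduct_generator_mul, Pi.mul_apply, reedMullerGenerator_succ_symm]
    rcases lt_trichotomy k l with h | rfl | h
    · simp [Pi.single_apply, h, h.not_gt, h.ne, mul_add, Finset.sum_add_distrib]
    · simp [Pi.single_apply, hdiag, mul_add, Finset.sum_add_distrib, CharTwo.add_self_eq_zero]
    · simp [Pi.single_apply, h, h.not_gt, h.ne', hsymm, mul_add, Finset.sum_add_distrib]
  refine ⟨S, Fin.cases (fun l => ?_) fun k => Fin.cases ?_ fun l => hsucc k l⟩
  · rw [reedMullerGenerator_zero, one_mul, hzero]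
  · rw [reedMullerGenerator_zero, mul_one, hzero, hsymm]

theorem exists_eq_reedMuller {B : BinaryCode n} (hn : n = 2 ^ m) (hone : 1 ∈ B)
    (hsep : (B : Set (Fin n → ZMod 2)).SeparatesPoints)
    (hrank : Module.finrank (ZMod 2) B = m + 1) :
    ∃ y : Fin n ≃ (Fin m → ZMod 2), B = reedMuller y := by
  have : NeZero n := ⟨hn ▸ by positivity⟩
  obtain ⟨f, rfl⟩ := exists_eq_span_range_cons hone one_ne_zero hrank
  have hinj : Function.Injective fun p j => f j p := fun p q hpq =>
    eq_of_separatesPoints_span hsep (Fin.cases rfl fun j => congrFun hpq j)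
  have hbij := (Fintype.bijective_iff_injective_and_card _).2 ⟨hinj, by simp [hn]⟩
  exact ⟨Equiv.ofBijective _ hbij, rfl⟩

theorem map_funLeft_reedMuller (y : Fin n ≃ (Fin m → ZMod 2)) (σ : Equiv.Perm (Fin n)) :
    (reedMuller y).map (LinearMap.funLeft (ZMod 2) (ZMod 2) σ) = reedMuller (σ.trans y) := by
  have hgen : LinearMap.funLeft (ZMod 2) (ZMod 2) σ ∘ reedMullerGenerator y =
      reedMullerGenerator (σ.trans y) := funext (Fin.cases rfl fun _ => rfl)
  rw [reedMuller, Submodule.map_span, ← Set.range_comp, hgen, reedMuller]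

theorem map_funLeft_reedMuller_trans_symm (x y : Fin n ≃ (Fin m → ZMod 2)) :
    (reedMuller y).map (LinearMap.funLeft (ZMod 2) (ZMod 2) (x.trans y.symm)) = reedMuller x := by
  rw [map_funLeft_reedMuller, Equiv.trans_assoc, Equiv.symm_trans_self, Equiv.trans_refl]

theorem equivalent_reedMuller (x y : Fin n ≃ (Fin m → ZMod 2)) :
    Equivalent (reedMuller y) (reedMuller x) :=
  ⟨x.trans y.symm, congrArg SetLike.coe (map_funLeft_reedMuller_trans_symm x y).symm⟩

/-- The labelling of the `32` positions for which `RM(1, 5)` has the generators `rmGenerator`. -/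
noncomputable def rmOneFiveLabelling : Fin 32 ≃ (Fin 5 → ZMod 2) :=
  Equiv.ofBijective (fun p j => rmGenerator j.succ p)
    ((Fintype.bijective_iff_injective_and_card _).2 ⟨by decide, rfl⟩)

theorem reedMuller_rmOneFiveLabelling : reedMuller rmOneFiveLabelling = rmOneFive := by
  have hgen : reedMullerGenerator rmOneFiveLabelling = rmGenerator :=
    funext (Fin.cases rfl fun _ => rfl)
  rw [reedMuller, hgen, rmOneFive]

end ReedMuller

end BinaryCode

namespace Z4Code

open BinaryCode

variable {m n : ℕ}

theorem IsTypeII.equivalent_of_residue_eq_reedMuller {C D : Z4Code n} (hC : C.IsTypeII)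
    (hD : D.IsTypeII) {x y : Fin n ≃ (Fin m → ZMod 2)} (hCres : C.residue = reedMuller x)
    (hDres : D.residue = reedMuller y) : Equivalent C D := by
  obtain ⟨S, hS⟩ := hC.exists_eq_map_signedPerm (reedMullerGenerator_zero x)
    (exists_dotProduct_generator_mul_generator x) (hD.map_signedPerm (x.trans y.symm) 1) hCres
    (by rw [residue_map_signedPerm, hCres, hDres, map_funLeft_reedMuller_trans_symm])
  exact (hS ▸ equivalent_map_signedPerm C 1 _).trans (equivalent_map_signedPerm D _ 1).symm

theorem IsTypeII.minEuclideanWeight_of_residue_eq_reedMuller {C : Z4Code n} (hC : C.IsTypeII)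
    (hm : 5 ≤ m) {x : Fin n ≃ (Fin m → ZMod 2)} (hres : C.residue = reedMuller x) :
    C.minEuclideanWeight = 16 := by
  have h01 : (⟨0, by lia⟩ : Fin m) ≠ ⟨1, by lia⟩ := by simp
  refine hC.minEuclideanWeight_eq_sixteen (hres ▸ separatesPoints_reedMuller x) ?_
    (hres ▸ planeWord_mem_dual x _ _) (planeWord_ne_zero x h01) (hammingNorm_planeWord_le x _ _)
  intro r hr hr0
  exact Nat.le_of_dvd (hammingNorm_pos_iff.2 hr0)
    (sixteen_dvd_hammingNorm_of_mem_reedMuller hm (hres ▸ hr))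

end Z4Code

open BinaryCode Z4Code in
theorem proposition3_general {m n : ℕ} (hm : 5 ≤ m) (x : Fin n ≃ (Fin m → ZMod 2)) :
    ∃ C : Z4Code n,
      C.IsTypeII ∧ C.minEuclideanWeight = 16 ∧
      Module.finrank (ZMod 2) C.residue = m + 1 ∧
      C.residue = reedMuller x ∧
      ∀ D : Z4Code n, D.IsTypeII → 8 < D.minEuclideanWeight →
        Module.finrank (ZMod 2) D.residue = m + 1 →
        Z4Code.Equivalent C D ∧ BinaryCode.Equivalent D.residue (reedMuller x) := by
  obtain ⟨C, hC, hres⟩ := exists_isTypeII_residue_eq (reedMullerGenerator_mem x 0) fun r hr =>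
    (by norm_num : 8 ∣ 16).trans (sixteen_dvd_hammingNorm_of_mem_reedMuller hm hr)
  refine ⟨C, hC, hC.minEuclideanWeight_of_residue_eq_reedMuller hm hres,
    hres ▸ finrank_reedMuller x, hres, fun D hD hmin hrank => ?_⟩
  obtain ⟨y, hy⟩ := exists_eq_reedMuller (length_eq_two_pow x) hD.one_mem_residue
    (hD.1.separatesPoints_residue hmin) hrank
  exact ⟨hC.equivalent_of_residue_eq_reedMuller hD hres hy, hy ▸ equivalent_reedMuller x y⟩

theorem proposition3 :
    ∃ C : Z4Code 32,
      C.IsExtremalTypeII ∧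
      Module.finrank (ZMod 2) C.residue = 6 ∧
      C.residue = BinaryCode.rmOneFive ∧
      ∀ D : Z4Code 32, D.IsExtremalTypeII → Module.finrank (ZMod 2) D.residue = 6 →
        Z4Code.Equivalent C D ∧ BinaryCode.Equivalent D.residue BinaryCode.rmOneFive := by
  obtain ⟨C, hC, hmin, hrank, hres, huniq⟩ :=
    proposition3_general le_rfl BinaryCode.rmOneFiveLabelling
  rw [BinaryCode.reedMuller_rmOneFiveLabelling] at hres huniq
  exact ⟨C, ⟨hC, hmin⟩, hrank, hres, fun D hD => huniq D hD.1 (hD.2 ▸ by norm_num)⟩
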